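/- Let $\mathfrak{g}$ be a finite-dimensional real Lie algebra with radical $\mathfrak{r}$ (largest solvable ideal) and nilradical $\mathfrak{n}$ (largest nilpotent ideal), and let $\mathfrak{g}=\mathfrak{r}+\mathfrak{s}$ be a Levi decomposition, i.e. $\mathfrak{s}$ is a Levi subalgebra: a semisimple subalgebra that is a vector space complement of $\mathfrak{r}$. Let $\mathfrak{s}_c$ (resp. $\mathfrak{s}_{nc}$) be the compact (resp. noncompact) part of $\mathfrak{s}$, i.e. the sum of those simple ideals of $\mathfrak{s}$ whose Killing form is (resp. is not) negative definite, so that $\mathfrak{s}=\mathfrak{s}_c\oplus\mathfrak{s}_{nc}$. For subalgebras $\mathfrak{h},\mathfrak{k}$ of $\mathfrak{g}$ write $\mathfrak{c}_{\mathfrak{h}}(\mathfrak{k})=\{x\in\mathfrak{h}: [x,\mathfrak{k}]=0\}$, and write $\mathfrak{c}(\mathfrak{n})$ for the center of $\mathfrak{n}$. A Lie algebra direct sum is a direct sum of vector spaces whose distinct summands commute. Then there is a Lie algebra direct sum $$\mathfrak{c}_{\mathfrak{g}}(\mathfrak{n})=(\mathfrak{c}_{\mathfrak{g}}(\mathfrak{n})\cap\mathfrak{r})\oplus(\mathfrak{c}_{\mathfrak{g}}(\mathfrak{n})\cap\mathfrak{s})=\mathfrak{c}_{\mathfrak{r}}(\mathfrak{n})\oplus\mathfrak{c}_{\mathfrak{s}}(\mathfrak{n}).$$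 Moreover: 1. $\mathfrak{c}_{\mathfrak{r}}(\mathfrak{n})=\mathfrak{c}(\mathfrak{n})$ is an abelian ideal of $\mathfrak{g}$, and $\mathfrak{c}_{\mathfrak{s}}(\mathfrak{n})=\mathfrak{c}_{\mathfrak{s}}(\mathfrak{r})$ is a semisimple (possibly zero) ideal of $\mathfrak{g}$. 2. $\mathfrak{c}_{\mathfrak{s}}(\mathfrak{r})$ is contained in every Levi subalgebra of $\mathfrak{g}$, and it does not depend on the choice of $\mathfrak{s}$: $\mathfrak{c}_{\mathfrak{t}}(\mathfrak{r})=\mathfrak{c}_{\mathfrak{s}}(\mathfrak{r})$ for every Levi subalgebra $\mathfrak{t}$. 3. There are Lie algebra direct sums $$\mathfrak{c}_{\mathfrak{s}}(\mathfrak{r})=\mathfrak{c}_{\mathfrak{s}_c}(\mathfrak{r})\oplus\mathfrak{c}_{\mathfrak{s}_{nc}}(\mathfrak{r}),\qquad \mathfrak{c}_{\mathfrak{g}}(\mathfrak{n})=\mathfrak{c}_{\mathfrak{s}_c}(\mathfrak{r})\oplus\mathfrak{c}_{\mathfrak{s}_{nc}}(\mathfrak{r})\oplus\mathfrak{c}(\mathfrak{n}),$$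 where each of $\mathfrak{c}_{\mathfrak{s}_c}(\mathfrak{r})$, $\mathfrak{c}_{\mathfrak{s}_{nc}}(\mathfrak{r})$ is a semisimple (possibly zero) ideal of $\mathfrak{g}$ and $\mathfrak{c}(\mathfrak{n})$ is an ideal of $\mathfrak{g}$. -/

import Mathlib

namespace LieAlgebra

section General

variable {L : Type*} [LieRing L] [LieAlgebra ℝ L]

/-- The nilradical of a Lie algebra: the sum of all ideals that are nilpotent as Lie algebras.
(In finite dimension this is the largest nilpotent ideal. Mathlib's `LieAlgebra.maxNilpotentIdeal`
is a different object: it only involves the ideals on which the whole of `L` acts nilpotently.) -/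
def lieNilradical (L : Type*) [LieRing L] [LieAlgebra ℝ L] : LieIdeal ℝ L :=
  sSup {I : LieIdeal ℝ L | LieRing.IsNilpotent I}

/-- A Levi subalgebra: a semisimple subalgebra which is a linear complement of the radical. -/
structure IsLeviSubalgebra (s : LieSubalgebra ℝ L) : Prop where
  isSemisimple : IsSemisimple ℝ s
  isCompl : IsCompl (radical ℝ L).toSubmodule s.toSubmodule

/-- The centralizer of a Lie subalgebra `k` in a Lie subalgebra `h`, i.e. the subalgebra of those
`x` in `h` with `⁅x, y⁆ = 0` for all `y` in `k`. -/
def centralizerIn (h k : LieSubalgebra ℝ L) : LieSubalgebra ℝ L where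
  carrier := {x | x ∈ h ∧ ∀ y ∈ k, ⁅x, y⁆ = 0}
  add_mem' := by
    rintro a b ⟨ha, ha'⟩ ⟨hb, hb'⟩
    exact ⟨h.add_mem ha hb, fun y hy => by rw [add_lie, ha' y hy, hb' y hy, add_zero]⟩
  zero_mem' := ⟨h.zero_mem, fun y _ => zero_lie y⟩
  smul_mem' := by
    rintro c a ⟨ha, ha'⟩
    exact ⟨h.smul_mem c ha, fun y hy => by rw [smul_lie, ha' y hy, smul_zero]⟩
  lie_mem' := by
    rintro a b ⟨ha, ha'⟩ ⟨hb, hb'⟩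
    exact ⟨h.lie_mem ha hb, fun y hy => by
      rw [lie_lie, ha' y hy, hb' y hy, lie_zero, lie_zero, sub_zero]⟩

/-- The center of an ideal `I` (regarded as a Lie algebra in its own right), as a subalgebra of the
ambient Lie algebra. -/
def centerOfIdeal (I : LieIdeal ℝ L) : LieSubalgebra ℝ L :=
  (center ℝ I).toLieSubalgebra.map I.incl

/-- The subalgebra `k` is an ideal of the ambient Lie algebra. -/
def IsIdeal (k : LieSubalgebra ℝ L) : Prop :=
  ∀ x : L, ∀ y ∈ k, ⁅x, y⁆ ∈ k

/-- `a` is the (internal) Lie algebra direct sum of the family `b` of subalgebras: it is their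
direct sum as a vector space, and distinct summands commute. -/
structure IsLieDirectSum {ι : Type*} (a : LieSubalgebra ℝ L) (b : ι → LieSubalgebra ℝ L) :
    Prop where
  iSup_eq : ⨆ i, (b i).toSubmodule = a.toSubmodule
  indep : iSupIndep fun i => (b i).toSubmodule
  commute : ∀ i j, i ≠ j → ∀ x ∈ b i, ∀ y ∈ b j, ⁅x, y⁆ = 0

/-- A real (semisimple) Lie algebra is of compact type if its Killing form is negative definite. -/
def IsCompactType (L : Type*) [LieRing L] [LieAlgebra ℝ L] : Prop :=
  ∀ x : L, x ≠ 0 → killingForm ℝ L x x < 0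

end General

section Semisimple

variable {L : Type*} [LieRing L] [LieAlgebra ℝ L]

/-- The compact part of a semisimple subalgebra `s`: the sum of all simple ideals of `s` of compact
type, as a subalgebra of the ambient Lie algebra. -/
def compactPart (s : LieSubalgebra ℝ L) : LieSubalgebra ℝ L :=
  (sSup {I : LieIdeal ℝ s | IsSimple ℝ I ∧ IsCompactType I}).toLieSubalgebra.map s.incl

/-- The noncompact part of a semisimple subalgebra `s`: the sum of all simple ideals of `s` that are
not of compact type, as a subalgebra of the ambient Lie algebra. -/
def noncompactPart (s : LieSubalgebra ℝ L) : LieSubalgebra ℝ L :=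
  (sSup {I : LieIdeal ℝ s | IsSimple ℝ I ∧ ¬ IsCompactType I}).toLieSubalgebra.map s.incl

end Semisimple

end LieAlgebra

open LieAlgebra

/-! Write `C` for the centralizer of the nilradical `n`; it is an ideal. Two facts control it. A
solvable ideal inside `C` lies in `n` (`le_lieNilradical_of_isSolvable`), so `C ∩ r` is the center
of `n`. Hence `[C, r] ⊆ C ∩ r ⊆ n` is killed by `C`, and by Jacobi `[C, C]` centralizes `r`
(`lie_nilradicalCentralizer_le`).

Let `P` be the perfect ideal at which the derived series of `C` stabilizes; it centralizes `r`. Such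
an ideal lies in every Levi subalgebra (`IsLeviSubalgebra.mem_of_lie_self_eq`), with no appeal to
conjugacy of Levi subalgebras. Ideals of a semisimple algebra are perfect, so the projection to `s`
along `r` sends `P` and `C` to the same ideal. As `P ⊆ s`, that ideal is `P`, whence `C = P ⊕ (C ∩
r)` and `P` is the centralizer in `s` of both `n` and `r`.

The compact/noncompact splitting uses nothing about compactness: any partition of the simple ideals
of `s` splits `P`. -/

namespace LieAlgebra

/-! ### Ideals of semisimple Lie algebras -/

section SemisimpleIdeals

variable {L : Type*} [LieRing L] [LieAlgebra ℝ L]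

/-- Over a semisimple Lie algebra, every ideal has a complementary ideal. -/
theorem IsSemisimple.exists_isCompl_lieIdeal [IsSemisimple ℝ L] (I : LieIdeal ℝ L) :
    ∃ J : LieIdeal ℝ L, IsCompl I J :=
  haveI := (IsSemisimple.booleanGenerators ℝ L).complementedLattice_of_sSup_eq_top
    IsSemisimple.sSup_atoms_eq_top
  exists_isCompl I

/-- Disjoint ideals commute. -/
theorem lie_eq_zero_of_disjoint {I J : LieIdeal ℝ L} (h : Disjoint I J) {x y : L}
    (hx : x ∈ I) (hy : y ∈ J) : ⁅x, y⁆ = 0 := by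
  rw [← LieSubmodule.mem_bot (R := ℝ) (L := L), ← h.eq_bot]
  exact LieSubmodule.lie_le_inf I J (LieSubmodule.lie_mem_lie hx hy)

/-- Every ideal of a semisimple Lie algebra is perfect. -/
theorem IsSemisimple.lie_lieIdeal_self [IsSemisimple ℝ L] (I : LieIdeal ℝ L) : ⁅I, I⁆ = I := by
  obtain ⟨J, hJ⟩ := IsSemisimple.exists_isCompl_lieIdeal ⁅I, I⁆
  refine le_antisymm (LieSubmodule.lie_le_left I I) ?_
  -- The derived ideal of `I ⊓ J` lies in both `⁅I, I⁆` and its complement `J`.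
  have hab : IsLieAbelian (I ⊓ J : LieIdeal ℝ L) := by
    rw [LieSubmodule.lie_abelian_iff_lie_self_eq_bot, eq_bot_iff, ← hJ.inf_eq_bot]
    exact le_inf (LieSubmodule.mono_lie inf_le_left inf_le_left)
      ((LieSubmodule.lie_le_left _ _).trans inf_le_right)
  have hbot := HasTrivialRadical.eq_bot_of_isSolvable (I ⊓ J)
  intro x hx
  have hx' : x ∈ ⁅I, I⁆ ⊔ J := hJ.sup_eq_top ▸ LieSubmodule.mem_top x
  obtain ⟨a, ha, b, hb, rfl⟩ := (LieSubmodule.mem_sup _ _ _).mp hx'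
  have hbI : b ∈ I := (add_mem_cancel_left (LieSubmodule.lie_le_left I I ha)).mp hx
  have hb0 : b ∈ I ⊓ J := ⟨hbI, hb⟩
  rw [hbot, LieSubmodule.mem_bot] at hb0
  simpa [hb0] using ha

/-- An ideal of a semisimple Lie algebra has trivial radical. -/
theorem IsSemisimple.hasTrivialRadical_lieIdeal [IsSemisimple ℝ L] (I : LieIdeal ℝ L) :
    HasTrivialRadical ℝ I := by
  obtain ⟨J, hJ⟩ := IsSemisimple.exists_isCompl_lieIdeal I
  rw [hasTrivialRadical_iff_no_abelian_ideals]
  intro A hA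
  -- The complement `J` commutes with `I`, so an ideal of `I` is stable under all of `L`.
  let A' : LieIdeal ℝ L :=
    { A.toSubmodule.map I.incl.toLinearMap with
      lie_mem := by
        rintro x _ ⟨y, hy, rfl⟩
        have hx : x ∈ I ⊔ J := hJ.sup_eq_top ▸ LieSubmodule.mem_top x
        obtain ⟨a, ha, b, hb, rfl⟩ := (LieSubmodule.mem_sup _ _ _).mp hx
        refine ⟨⁅(⟨a, ha⟩ : I), (y : I)⁆, lie_mem_right ℝ I A _ _ hy, ?_⟩
        change ⁅a, (y : L)⁆ = ⁅a + b, (y : L)⁆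
        rw [add_lie, lie_eq_zero_of_disjoint hJ.disjoint.symm hb y.2, add_zero] }
  have hA' : IsLieAbelian A' := by
    rw [LieSubmodule.lie_abelian_iff_lie_self_eq_bot, LieSubmodule.lie_eq_bot_iff]
    rintro _ ⟨x, hx, rfl⟩ _ ⟨y, hy, rfl⟩
    rw [LieSubmodule.lie_abelian_iff_lie_self_eq_bot, LieSubmodule.lie_eq_bot_iff] at hA
    exact congrArg Subtype.val (hA x hx y hy)
  have hbot := HasTrivialRadical.eq_bot_of_isSolvable A'
  rw [eq_bot_iff]
  intro x hx
  have hx' : (x : L) ∈ A' := ⟨x, hx, rfl⟩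
  rw [hbot, LieSubmodule.mem_bot] at hx'
  simpa using hx'

theorem isAtom_of_isSimple (I : LieIdeal ℝ L) [hI : IsSimple ℝ I] : IsAtom I := by
  refine ⟨?_, fun J hJ => ?_⟩
  · rintro rfl
    exact hI.non_abelian inferInstance
  · rcases hI.eq_bot_or_eq_top (J.comap I.incl) with h | h
    · rw [LieIdeal.comap_incl_eq_bot, disjoint_iff, inf_eq_right.mpr hJ.le] at h
      exact h
    · rw [LieIdeal.comap_incl_eq_top] at h
      exact absurd hJ h.not_gt

/-- The ideals of a semisimple Lie algebra split along any partition of the simple ideals. -/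
theorem IsSemisimple.isCompl_sSup_isSimple [IsSemisimple ℝ L] (p : LieIdeal ℝ L → Prop) :
    IsCompl (sSup {I : LieIdeal ℝ L | IsSimple ℝ I ∧ p I})
      (sSup {I : LieIdeal ℝ L | IsSimple ℝ I ∧ ¬ p I}) := by
  have h₁ : {I : LieIdeal ℝ L | IsSimple ℝ I ∧ p I} ⊆ {I | IsAtom I} :=
    fun I hI => haveI := hI.1; isAtom_of_isSimple I
  have h₂ : {I : LieIdeal ℝ L | IsSimple ℝ I ∧ ¬ p I} ⊆ {I | IsAtom I} :=
    fun I hI => haveI := hI.1; isAtom_of_isSimple I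
  constructor
  · rw [disjoint_iff, ← (IsSemisimple.booleanGenerators ℝ L).sSup_inter h₁ h₂, eq_bot_iff]
    exact sSup_le fun I hI => absurd hI.1.2 hI.2.2
  · rw [codisjoint_iff, ← sSup_union, eq_top_iff, ← IsSemisimple.sSup_atoms_eq_top]
    refine sSup_le_sSup fun I hI => ?_
    have := IsSemisimple.isSimple_of_isAtom I hI
    by_cases hp : p I
    · exact Or.inl ⟨this, hp⟩
    · exact Or.inr ⟨this, hp⟩

/-- Distributivity comes from perfectness: `K = ⁅K, K⁆ ≤ ⁅K, I⁆ ⊔ ⁅K, J⁆`. -/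
theorem IsSemisimple.inf_sup_inf_of_isCompl [IsSemisimple ℝ L] (K : LieIdeal ℝ L)
    {I J : LieIdeal ℝ L} (h : IsCompl I J) : (K ⊓ I) ⊔ (K ⊓ J) = K := by
  refine le_antisymm (sup_le inf_le_left inf_le_left) ?_
  conv_lhs => rw [← IsSemisimple.lie_lieIdeal_self K]
  calc ⁅K, K⁆ ≤ ⁅K, I ⊔ J⁆ := LieSubmodule.mono_lie_right K (h.sup_eq_top ▸ le_top)
    _ = ⁅K, I⁆ ⊔ ⁅K, J⁆ := LieSubmodule.lie_sup I J K
    _ ≤ _ := sup_le_sup (LieSubmodule.lie_le_inf K I) (LieSubmodule.lie_le_inf K J)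

/-- The image in `L` of an ideal of a semisimple subalgebra is semisimple. -/
theorem IsSemisimple.map_incl [FiniteDimensional ℝ L] (s : LieSubalgebra ℝ L) [IsSemisimple ℝ s]
    (I : LieIdeal ℝ s) : IsSemisimple ℝ (I.toLieSubalgebra.map s.incl) := by
  have := IsSemisimple.hasTrivialRadical_lieIdeal I
  let e : I ≃ₗ⁅ℝ⁆ I.toLieSubalgebra.map s.incl :=
    (LieEquiv.ofInjective (s.incl.comp I.incl)
      (Subtype.val_injective.comp Subtype.val_injective)).trans
      (LieEquiv.ofEq _ _ (by
        ext x
        simp only [SetLike.mem_coe, LieHom.mem_range, LieSubalgebra.mem_map]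
        exact ⟨fun ⟨y, hy⟩ => ⟨y.1, y.2, hy⟩, fun ⟨y, hy, h⟩ => ⟨⟨y, hy⟩, h⟩⟩))
  -- Semisimplicity is transported along `e` as nondegeneracy of the Killing form, which the trivial
  -- radical of `I` provides.
  have := e.isKilling
  infer_instance

end SemisimpleIdeals

/-! ### The centralizer of the nilradical -/

section Centralizer

variable {L : Type*} [LieRing L] [LieAlgebra ℝ L]

theorem lieNilradical_le_radical : lieNilradical L ≤ radical ℝ L :=
  sSup_le_sSup fun I (_ : LieRing.IsNilpotent I) => show IsSolvable I from inferInstance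

/-- The centralizer of the nilradical, as an ideal. -/
def nilradicalCentralizer (L : Type*) [LieRing L] [LieAlgebra ℝ L] : LieIdeal ℝ L :=
  LieModule.ker ℝ L (lieNilradical L)

theorem mem_nilradicalCentralizer {x : L} :
    x ∈ nilradicalCentralizer L ↔ ∀ y ∈ lieNilradical L, ⁅x, y⁆ = 0 := by
  rw [nilradicalCentralizer, LieModule.mem_ker]
  exact ⟨fun h y hy => congrArg Subtype.val (h ⟨y, hy⟩), fun h y => Subtype.ext (h y y.2)⟩

/-- The hypothesis brackets ideals of `L`, while nilpotency refers to the lower central series of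
`I` itself; pulling back along `I.incl` compares the two. -/
theorem isNilpotent_of_lie_lie_eq_bot (I : LieIdeal ℝ L) (h : ⁅I, ⁅I, I⁆⁆ = ⊥) :
    LieRing.IsNilpotent I := by
  refine LieModule.IsNilpotent.mk (R := ℝ) (L := I) (M := I) (k := 2) ?_
  rw [LieModule.lowerCentralSeries_succ, LieModule.lowerCentralSeries_succ,
    LieModule.lowerCentralSeries_zero, LieSubmodule.lie_eq_bot_iff]
  have hle : ⁅(⊤ : LieIdeal ℝ I), (⊤ : LieIdeal ℝ I)⁆ ≤ LieIdeal.comap I.incl ⁅I, I⁆ := by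
    rw [LieSubmodule.lie_le_iff]
    intro x _ y _
    exact LieSubmodule.lie_mem_lie x.2 y.2
  rw [LieSubmodule.lie_eq_bot_iff] at h
  intro x _ y hy
  exact Subtype.ext (h x x.2 y (hle hy))

/-- A solvable ideal centralizing the nilradical is contained in the nilradical: otherwise its last
derived ideal outside the nilradical would be nilpotent. -/
theorem le_lieNilradical_of_isSolvable (I : LieIdeal ℝ L) [IsSolvable I]
    (hI : I ≤ nilradicalCentralizer L) : I ≤ lieNilradical L := by
  obtain ⟨k, hk⟩ := IsSolvable.solvable ℝ I
  rw [LieIdeal.derivedSeries_eq_bot_iff] at hk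
  -- Descent along the derived series, from `⊥` at stage `k` back to `I` at stage `0`.
  suffices ∀ j, derivedSeriesOfIdeal ℝ L j I ≤ lieNilradical L → I ≤ lieNilradical L from
    this k (hk ▸ bot_le)
  intro j
  induction j with
  | zero => exact id
  | succ j ih =>
    refine fun h => ih (le_sSup (isNilpotent_of_lie_lie_eq_bot _ ?_))
    rw [derivedSeriesOfIdeal_succ] at h
    rw [LieSubmodule.lie_eq_bot_iff]
    intro x hx y hy
    exact mem_nilradicalCentralizer.mp (hI (derivedSeriesOfIdeal_le_self I j hx)) y (h hy)

theorem lie_eq_zero_of_mem_ker_radical {x : L} (hx : x ∈ LieModule.ker ℝ L (radical ℝ L)) {a : L}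
    (ha : a ∈ radical ℝ L) : ⁅x, a⁆ = 0 := by
  rw [LieModule.mem_ker] at hx
  exact congrArg Subtype.val (hx ⟨a, ha⟩)

variable [FiniteDimensional ℝ L]

theorem mem_lieNilradical_of_mem_radical {x : L} (hx : x ∈ nilradicalCentralizer L)
    (hx' : x ∈ radical ℝ L) : x ∈ lieNilradical L := by
  have : IsSolvable (nilradicalCentralizer L ⊓ radical ℝ L : LieIdeal ℝ L) :=
    LieAlgebra.le_solvable_ideal_solvable inf_le_right inferInstance
  exact le_lieNilradical_of_isSolvable (nilradicalCentralizer L ⊓ radical ℝ L) inf_le_left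
    ⟨hx, hx'⟩

/-- The derived ideal of the centralizer of the nilradical centralizes the radical. -/
theorem lie_nilradicalCentralizer_le :
    ⁅nilradicalCentralizer L, nilradicalCentralizer L⁆ ≤ LieModule.ker ℝ L (radical ℝ L) := by
  rw [LieSubmodule.lie_le_iff]
  intro x hx y hy
  rw [LieModule.mem_ker]
  intro a
  have key : ∀ u ∈ nilradicalCentralizer L, ⁅u, (a : L)⁆ ∈ lieNilradical L := fun u hu =>
    mem_lieNilradical_of_mem_radical (lie_mem_left ℝ L _ _ _ hu) (lie_mem_right ℝ L _ _ _ a.2)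
  refine Subtype.ext ?_
  change ⁅⁅x, y⁆, (a : L)⁆ = 0
  rw [lie_lie, mem_nilradicalCentralizer.mp hx _ (key y hy),
    mem_nilradicalCentralizer.mp hy _ (key x hx), sub_zero]

/-- The derived series of an ideal stabilizes at a perfect ideal. -/
theorem exists_lie_derivedSeriesOfIdeal_self (I : LieIdeal ℝ L) :
    ∃ k, ⁅derivedSeriesOfIdeal ℝ L k I, derivedSeriesOfIdeal ℝ L k I⁆ =
      derivedSeriesOfIdeal ℝ L k I := by
  have := LieSubmodule.wellFoundedLT_of_isArtinian ℝ L L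
  obtain ⟨k, hk⟩ := WellFoundedLT.antitone_chain_condition
    (f := fun k => derivedSeriesOfIdeal ℝ L k I) fun _ _ h => derivedSeriesOfIdeal_antitone I h
  refine ⟨k, ?_⟩
  rw [← derivedSeriesOfIdeal_succ]
  exact (hk (k + 1) k.le_succ).symm

end Centralizer

/-! ### Projection to a Levi subalgebra -/

section Levi

variable {L : Type*} [LieRing L] [LieAlgebra ℝ L] {s : LieSubalgebra ℝ L}

theorem IsLeviSubalgebra.exists_add (hs : IsLeviSubalgebra s) (x : L) :
    ∃ a ∈ radical ℝ L, ∃ b ∈ s, a + b = x :=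
  Submodule.mem_sup.mp (hs.isCompl.sup_eq_top ▸ Submodule.mem_top)

theorem IsLeviSubalgebra.eq_zero (hs : IsLeviSubalgebra s) {x : L} (hx : x ∈ radical ℝ L)
    (hx' : x ∈ s) : x = 0 :=
  Submodule.disjoint_def.mp hs.isCompl.disjoint x hx hx'

/-- The projection onto a Levi subalgebra along the radical. -/
noncomputable def IsLeviSubalgebra.proj (hs : IsLeviSubalgebra s) : L →ₗ⁅ℝ⁆ s where
  toLinearMap := s.toSubmodule.projectionOnto (radical ℝ L).toSubmodule hs.isCompl.symm
  map_lie' := by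
    intro x y
    obtain ⟨a, ha, b, hb, rfl⟩ := hs.exists_add x
    obtain ⟨a', ha', b', hb', rfl⟩ := hs.exists_add y
    let p : L →ₗ[ℝ] s := s.toSubmodule.projectionOnto (radical ℝ L).toSubmodule hs.isCompl.symm
    have key : ∀ u ∈ radical ℝ L, ∀ v (hv : v ∈ s), p (u + v) = ⟨v, hv⟩ := by
      intro u hu v hv
      rw [map_add, (Submodule.projectionOnto_apply_eq_zero_iff _).mpr hu, zero_add]
      exact Submodule.projectionOnto_apply_left hs.isCompl.symm ⟨v, hv⟩
    have hlie : ⁅a + b, a' + b'⁆ = (⁅a, a' + b'⁆ + ⁅b, a'⁆) + ⁅b, b'⁆ := by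
      rw [add_lie, lie_add b, add_assoc]
    have hr : ⁅a, a' + b'⁆ + ⁅b, a'⁆ ∈ radical ℝ L :=
      add_mem (lie_mem_left ℝ L _ _ _ ha) (lie_mem_right ℝ L _ _ _ ha')
    change p _ = ⁅p _, p _⁆
    rw [hlie, key _ hr _ (s.lie_mem hb hb'), key a ha b hb, key a' ha' b' hb']
    rfl

theorem IsLeviSubalgebra.proj_of_mem (hs : IsLeviSubalgebra s) {x : L} (hx : x ∈ s) :
    (hs.proj x : L) = x :=
  congrArg Subtype.val (Submodule.projectionOnto_apply_left hs.isCompl.symm ⟨x, hx⟩)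

theorem IsLeviSubalgebra.proj_surjective (hs : IsLeviSubalgebra s) :
    Function.Surjective hs.proj := fun x => ⟨x, Subtype.ext (hs.proj_of_mem x.2)⟩

theorem IsLeviSubalgebra.sub_proj_mem (hs : IsLeviSubalgebra s) (x : L) :
    x - hs.proj x ∈ radical ℝ L :=
  Submodule.sub_projection_mem hs.isCompl.symm x

/-- The image of `I` is an ideal of the semisimple `s`, hence perfect, so passing to derived ideals
loses nothing in `s`. -/
theorem IsLeviSubalgebra.map_proj_derivedSeriesOfIdeal (hs : IsLeviSubalgebra s)
    (I : LieIdeal ℝ L) (k : ℕ) :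
    LieIdeal.map hs.proj (derivedSeriesOfIdeal ℝ L k I) = LieIdeal.map hs.proj I := by
  have := hs.isSemisimple
  induction k with
  | zero => rfl
  | succ k ih =>
    rw [derivedSeriesOfIdeal_succ, LieIdeal.map_bracket_eq hs.proj hs.proj_surjective, ih,
      IsSemisimple.lie_lieIdeal_self]

variable [FiniteDimensional ℝ L]

/-- A perfect ideal centralizing the radical lies in every Levi subalgebra. -/
theorem IsLeviSubalgebra.mem_of_lie_self_eq (hs : IsLeviSubalgebra s) {P : LieIdeal ℝ L}
    (hP : ⁅P, P⁆ = P) (hr : P ≤ LieModule.ker ℝ L (radical ℝ L)) {x : L} (hx : x ∈ P) : x ∈ s := by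
  have hr' : ∀ x ∈ P, ∀ a ∈ radical ℝ L, ⁅x, a⁆ = 0 := fun x hx a ha =>
    lie_eq_zero_of_mem_ker_radical (hr hx) ha
  -- The radical component of `x` sinks through the derived series of the solvable radical, so it
  -- vanishes.
  have key : ∀ k, ∀ x ∈ P, x - hs.proj x ∈ derivedSeriesOfIdeal ℝ L k (radical ℝ L) := by
    intro k
    induction k with
    | zero => exact fun x _ => hs.sub_proj_mem x
    | succ k ih =>
      intro x hx
      rw [← hP, ← LieSubmodule.mem_toSubmodule, LieSubmodule.lieIdeal_oper_eq_linear_span'] at hx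
      induction hx using Submodule.span_induction with
      | mem x hx =>
        obtain ⟨y, hy, z, hz, rfl⟩ := hx
        -- Since `y` and `z` centralize the radical, `⁅y, z⁆` equals both `⁅y, hs.proj z⁆` and
        -- `⁅hs.proj y, z⁆`.
        have h : ⁅y, z⁆ - (hs.proj ⁅y, z⁆ : L) = - ⁅y - hs.proj y, z - hs.proj z⁆ := by
          have h₁ := hr' y hy _ (hs.sub_proj_mem z)
          have h₂ := hr' z hz _ (hs.sub_proj_mem y)
          rw [← lie_skew, neg_eq_zero] at h₂
          rw [LieHom.map_lie, LieSubalgebra.coe_bracket]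
          rw [lie_sub, sub_eq_zero] at h₁
          rw [sub_lie, sub_eq_zero] at h₂
          rw [sub_lie, lie_sub, lie_sub, h₁, ← h₂, h₁]
          abel
        rw [h, derivedSeriesOfIdeal_succ]
        exact neg_mem (LieSubmodule.lie_mem_lie (ih y hy) (ih z hz))
      | zero => simp
      | add x y _ _ hx hy =>
        rw [map_add, AddMemClass.coe_add, add_sub_add_comm]
        exact add_mem hx hy
      | smul c x _ hx =>
        rw [map_smul, SetLike.val_smul, ← smul_sub]
        exact (derivedSeriesOfIdeal ℝ L (k + 1) (radical ℝ L)).smul_mem c hx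
  obtain ⟨k, hk⟩ := IsSolvable.solvable ℝ (radical ℝ L)
  rw [LieIdeal.derivedSeries_eq_bot_iff] at hk
  have := key k x hx
  rw [hk, LieSubmodule.mem_bot, sub_eq_zero] at this
  rw [this]
  exact (hs.proj x).2

variable (L) in
/-- The perfect part of the centralizer of the nilradical: it centralizes the radical, lies in every
Levi subalgebra `s`, and contains the projection to `s` of the centralizer of the nilradical. -/
theorem exists_perfect_nilradicalCentralizer : ∃ P : LieIdeal ℝ L,
    P ≤ nilradicalCentralizer L ∧ (∀ x ∈ P, ∀ a ∈ radical ℝ L, ⁅x, a⁆ = 0) ∧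
    ∀ (s : LieSubalgebra ℝ L) (hs : IsLeviSubalgebra s),
      (∀ x ∈ P, x ∈ s) ∧ ∀ x ∈ nilradicalCentralizer L, (hs.proj x : L) ∈ P := by
  obtain ⟨k, hk⟩ := exists_lie_derivedSeriesOfIdeal_self (nilradicalCentralizer L)
  have hle := derivedSeriesOfIdeal_le_self (R := ℝ) (nilradicalCentralizer L) k
  have hker : derivedSeriesOfIdeal ℝ L k (nilradicalCentralizer L) ≤
      LieModule.ker ℝ L (radical ℝ L) :=
    hk.ge.trans ((LieSubmodule.mono_lie hle hle).trans lie_nilradicalCentralizer_le)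
  refine ⟨_, hle, fun x hx a ha => ?_, fun s hs => ?_⟩
  · exact lie_eq_zero_of_mem_ker_radical (hker hx) ha
  · have hmem : ∀ x ∈ derivedSeriesOfIdeal ℝ L k (nilradicalCentralizer L), x ∈ s :=
      fun x hx => hs.mem_of_lie_self_eq hk hker hx
    refine ⟨hmem, fun x hx => ?_⟩
    have hx' := LieIdeal.mem_map (f := hs.proj) hx
    rw [← hs.map_proj_derivedSeriesOfIdeal _ k] at hx'
    -- `y` lies in the perfect ideal, hence in `s`, so the projection of `x` is `y` itself.
    obtain ⟨y, hy⟩ := LieIdeal.mem_map_of_surjective hs.proj_surjective hx'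
    rw [← hy, hs.proj_of_mem (hmem y y.2)]
    exact y.2

end Levi

/-! ### Direct sums of two and three subalgebras -/

section DirectSum

variable {L : Type*} [LieRing L] [LieAlgebra ℝ L]

theorem isLieDirectSum_pair {a b c : LieSubalgebra ℝ L}
    (hsup : b.toSubmodule ⊔ c.toSubmodule = a.toSubmodule)
    (hdisj : Disjoint b.toSubmodule c.toSubmodule)
    (hcomm : ∀ x ∈ b, ∀ y ∈ c, ⁅x, y⁆ = 0) : IsLieDirectSum a ![b, c] where
  iSup_eq := by
    rw [← hsup]
    refine le_antisymm (iSup_le fun i => ?_)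
      (sup_le (le_iSup_of_le 0 le_rfl) (le_iSup_of_le 1 le_rfl))
    fin_cases i
    exacts [le_sup_left, le_sup_right]
  indep := by
    intro i
    fin_cases i
    · refine hdisj.mono_right (iSup₂_le fun j hj => ?_)
      fin_cases j
      exacts [absurd rfl hj, le_rfl]
    · refine hdisj.symm.mono_right (iSup₂_le fun j hj => ?_)
      fin_cases j
      exacts [le_rfl, absurd rfl hj]
  commute := by
    intro i j hij x hx y hy
    fin_cases i <;> fin_cases j
    exacts [absurd rfl hij, hcomm x hx y hy, by rw [← lie_skew, hcomm y hy x hx, neg_zero],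
      absurd rfl hij]

theorem isLieDirectSum_triple {a b c d : LieSubalgebra ℝ L}
    (hsup : b.toSubmodule ⊔ c.toSubmodule ⊔ d.toSubmodule = a.toSubmodule)
    (hdisj : Disjoint b.toSubmodule c.toSubmodule)
    (hdisj' : Disjoint (b.toSubmodule ⊔ c.toSubmodule) d.toSubmodule)
    (hbc : ∀ x ∈ b, ∀ y ∈ c, ⁅x, y⁆ = 0) (hbd : ∀ x ∈ b, ∀ y ∈ d, ⁅x, y⁆ = 0)
    (hcd : ∀ x ∈ c, ∀ y ∈ d, ⁅x, y⁆ = 0) : IsLieDirectSum a ![b, c, d] where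
  iSup_eq := by
    rw [← hsup]
    refine le_antisymm (iSup_le fun i => ?_) (sup_le (sup_le (le_iSup_of_le 0 le_rfl)
      (le_iSup_of_le 1 le_rfl)) (le_iSup_of_le 2 le_rfl))
    fin_cases i
    exacts [le_sup_left.trans le_sup_left, le_sup_right.trans le_sup_left, le_sup_right]
  indep := by
    have hb : Disjoint b.toSubmodule (c.toSubmodule ⊔ d.toSubmodule) :=
      hdisj.disjoint_sup_right_of_disjoint_sup_left hdisj'
    have hc : Disjoint c.toSubmodule (b.toSubmodule ⊔ d.toSubmodule) :=
      hdisj.symm.disjoint_sup_right_of_disjoint_sup_left (sup_comm c.toSubmodule _ ▸ hdisj')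
    intro i
    fin_cases i
    · refine hb.mono_right (iSup₂_le fun j hj => ?_)
      fin_cases j
      exacts [absurd rfl hj, le_sup_left, le_sup_right]
    · refine hc.mono_right (iSup₂_le fun j hj => ?_)
      fin_cases j
      exacts [le_sup_left, absurd rfl hj, le_sup_right]
    · refine hdisj'.symm.mono_right (iSup₂_le fun j hj => ?_)
      fin_cases j
      exacts [le_sup_left, le_sup_right, absurd rfl hj]
  commute := by
    have skew : ∀ {u v : LieSubalgebra ℝ L}, (∀ x ∈ u, ∀ y ∈ v, ⁅x, y⁆ = 0) →
        ∀ x ∈ v, ∀ y ∈ u, ⁅x, y⁆ = 0 := fun h x hx y hy => by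
      rw [← lie_skew, h y hy x hx, neg_zero]
    intro i j hij
    fin_cases i <;> fin_cases j
    exacts [absurd rfl hij, hbc, hbd, skew hbc, absurd rfl hij, hcd, skew hbd, skew hcd,
      absurd rfl hij]

end DirectSum

end LieAlgebra

namespace LieAlgebra

/-! ### Centralizers of the radical as ideals of `s` -/

section Parts

variable {L : Type*} [LieRing L] [LieAlgebra ℝ L]

/-- Turns centralizing the radical into meeting with `P`, so that the lattice of ideals of `s`
handles both parts. -/
theorem centralizerIn_radical_eq_map {s : LieSubalgebra ℝ L} {P : LieIdeal ℝ L}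
    (hP : centralizerIn s (radical ℝ L).toLieSubalgebra = P.toLieSubalgebra) (I : LieIdeal ℝ s) :
    centralizerIn (I.toLieSubalgebra.map s.incl) (radical ℝ L).toLieSubalgebra =
      (P.comap s.incl ⊓ I).toLieSubalgebra.map s.incl := by
  have key : ∀ x : s, (x : L) ∈ P ↔ ∀ y ∈ radical ℝ L, ⁅(x : L), y⁆ = 0 := fun x => by
    rw [← LieIdeal.mem_toLieSubalgebra, ← hP]
    exact ⟨fun h => h.2, fun h => ⟨x.2, h⟩⟩
  ext x
  constructor
  · rintro ⟨⟨y, hy, rfl⟩, hx⟩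
    exact ⟨y, ⟨(key y).mpr hx, hy⟩, rfl⟩
  · rintro ⟨y, ⟨hy, hy'⟩, rfl⟩
    exact ⟨⟨y, hy', rfl⟩, (key y).mp hy⟩

/-- An ideal of a Levi subalgebra that centralizes the radical is an ideal of the whole algebra. -/
theorem IsLeviSubalgebra.isIdeal_map_incl {s : LieSubalgebra ℝ L} (hs : IsLeviSubalgebra s)
    {I : LieIdeal ℝ s} (hI : ∀ x ∈ I, ∀ a ∈ radical ℝ L, ⁅(x : L), a⁆ = 0) :
    IsIdeal (I.toLieSubalgebra.map s.incl) := by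
  rintro x _ ⟨y, hy, rfl⟩
  obtain ⟨a, ha, b, hb, rfl⟩ := hs.exists_add x
  refine ⟨⁅(⟨b, hb⟩ : s), y⁆, lie_mem_right ℝ s I _ _ hy, ?_⟩
  change ⁅b, (y : L)⁆ = ⁅a + b, (y : L)⁆
  rw [add_lie, ← lie_skew a, hI y hy a ha, neg_zero, zero_add]

theorem map_incl_sup {s : LieSubalgebra ℝ L} (I J : LieIdeal ℝ s) :
    (I.toLieSubalgebra.map s.incl).toSubmodule ⊔ (J.toLieSubalgebra.map s.incl).toSubmodule =
      ((I ⊔ J).toLieSubalgebra.map s.incl).toSubmodule := by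
  change I.toSubmodule.map s.toSubmodule.subtype ⊔ J.toSubmodule.map s.toSubmodule.subtype =
    (I ⊔ J).toSubmodule.map s.toSubmodule.subtype
  rw [← Submodule.map_sup, LieSubmodule.sup_toSubmodule]

theorem disjoint_map_incl {s : LieSubalgebra ℝ L} {I J : LieIdeal ℝ s} (h : Disjoint I J) :
    Disjoint (I.toLieSubalgebra.map s.incl).toSubmodule
      (J.toLieSubalgebra.map s.incl).toSubmodule := by
  rw [Submodule.disjoint_def]
  rintro _ ⟨x, hx, rfl⟩ ⟨y, hy, hxy⟩
  obtain rfl : y = x := Subtype.ext hxy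
  have : y ∈ I ⊓ J := ⟨hx, hy⟩
  rw [h.eq_bot, LieSubmodule.mem_bot] at this
  rw [this, map_zero]

theorem centralizerIn_radical_lieNilradical [FiniteDimensional ℝ L] :
    centralizerIn (radical ℝ L).toLieSubalgebra (lieNilradical L).toLieSubalgebra =
      centerOfIdeal (lieNilradical L) := by
  ext x
  constructor
  · rintro ⟨hx, hx'⟩
    refine ⟨⟨x, mem_lieNilradical_of_mem_radical (mem_nilradicalCentralizer.mpr hx') hx⟩, ?_, rfl⟩
    refine (LieModule.mem_maxTrivSubmodule ℝ _ _ _).mpr fun y => Subtype.ext ?_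
    change ⁅(y : L), x⁆ = 0
    rw [← lie_skew, hx' y y.2, neg_zero]
  · rintro ⟨y, hy, rfl⟩
    refine ⟨lieNilradical_le_radical y.2, fun z hz => ?_⟩
    have := congrArg Subtype.val ((LieModule.mem_maxTrivSubmodule ℝ _ _ _).mp hy ⟨z, hz⟩)
    change ⁅(y : L), z⁆ = 0
    rw [← lie_skew, neg_eq_zero]
    exact this

end Parts

end LieAlgebra

/-! ### Assembly of the theorem -/

theorem lemma10 {𝔤 : Type*} [LieRing 𝔤] [LieAlgebra ℝ 𝔤] [FiniteDimensional ℝ 𝔤]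
    (𝔰 : LieSubalgebra ℝ 𝔤) (h𝔰 : IsLeviSubalgebra 𝔰) :
    -- the decomposition of the centralizer of the nilradical in `𝔤`
    (IsLieDirectSum (centralizerIn ⊤ (lieNilradical 𝔤).toLieSubalgebra)
        ![centralizerIn ⊤ (lieNilradical 𝔤).toLieSubalgebra ⊓ (radical ℝ 𝔤).toLieSubalgebra,
          centralizerIn ⊤ (lieNilradical 𝔤).toLieSubalgebra ⊓ 𝔰] ∧
      centralizerIn ⊤ (lieNilradical 𝔤).toLieSubalgebra ⊓ (radical ℝ 𝔤).toLieSubalgebra =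
        centralizerIn (radical ℝ 𝔤).toLieSubalgebra (lieNilradical 𝔤).toLieSubalgebra ∧
      centralizerIn ⊤ (lieNilradical 𝔤).toLieSubalgebra ⊓ 𝔰 = centralizerIn 𝔰 (lieNilradical 𝔤).toLieSubalgebra) ∧
    -- the first summand is the center of the nilradical, an abelian ideal
    (centralizerIn (radical ℝ 𝔤).toLieSubalgebra (lieNilradical 𝔤).toLieSubalgebra = centerOfIdeal (lieNilradical 𝔤) ∧
      IsIdeal (centerOfIdeal (lieNilradical 𝔤)) ∧
      IsLieAbelian (centerOfIdeal (lieNilradical 𝔤))) ∧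
    -- the second summand is the centralizer of the radical in `𝔰`, a semisimple ideal
    (centralizerIn 𝔰 (lieNilradical 𝔤).toLieSubalgebra = centralizerIn 𝔰 (radical ℝ 𝔤).toLieSubalgebra ∧
      IsIdeal (centralizerIn 𝔰 (radical ℝ 𝔤).toLieSubalgebra) ∧
      IsSemisimple ℝ (centralizerIn 𝔰 (radical ℝ 𝔤).toLieSubalgebra)) ∧
    -- it lies in every Levi subalgebra and does not depend on the choice of `𝔰`
    (∀ 𝔱 : LieSubalgebra ℝ 𝔤, IsLeviSubalgebra 𝔱 →
      centralizerIn 𝔰 (radical ℝ 𝔤).toLieSubalgebra ≤ 𝔱 ∧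
      centralizerIn 𝔱 (radical ℝ 𝔤).toLieSubalgebra = centralizerIn 𝔰 (radical ℝ 𝔤).toLieSubalgebra) ∧
    -- the refinement by the compact and noncompact parts of `𝔰`
    IsLieDirectSum (centralizerIn 𝔰 (radical ℝ 𝔤).toLieSubalgebra)
      ![centralizerIn (compactPart 𝔰) (radical ℝ 𝔤).toLieSubalgebra,
        centralizerIn (noncompactPart 𝔰) (radical ℝ 𝔤).toLieSubalgebra] ∧
    IsLieDirectSum (centralizerIn ⊤ (lieNilradical 𝔤).toLieSubalgebra)
      ![centralizerIn (compactPart 𝔰) (radical ℝ 𝔤).toLieSubalgebra,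
        centralizerIn (noncompactPart 𝔰) (radical ℝ 𝔤).toLieSubalgebra,
        centerOfIdeal (lieNilradical 𝔤)] ∧
    (IsIdeal (centralizerIn (compactPart 𝔰) (radical ℝ 𝔤).toLieSubalgebra) ∧
      IsSemisimple ℝ (centralizerIn (compactPart 𝔰) (radical ℝ 𝔤).toLieSubalgebra)) ∧
    (IsIdeal (centralizerIn (noncompactPart 𝔰) (radical ℝ 𝔤).toLieSubalgebra) ∧
      IsSemisimple ℝ (centralizerIn (noncompactPart 𝔰) (radical ℝ 𝔤).toLieSubalgebra)) := by
  obtain ⟨P, hPC, hPr, hP⟩ := exists_perfect_nilradicalCentralizer 𝔤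
  have hC : centralizerIn ⊤ (lieNilradical 𝔤).toLieSubalgebra =
      (nilradicalCentralizer 𝔤).toLieSubalgebra := by
    ext x
    exact ⟨fun h => mem_nilradicalCentralizer.mpr h.2,
      fun h => ⟨LieSubalgebra.mem_top x, mem_nilradicalCentralizer.mp h⟩⟩
  have hCr : centralizerIn ⊤ (lieNilradical 𝔤).toLieSubalgebra ⊓ (radical ℝ 𝔤).toLieSubalgebra =
      centralizerIn (radical ℝ 𝔤).toLieSubalgebra (lieNilradical 𝔤).toLieSubalgebra := by
    ext x
    exact ⟨fun h => ⟨h.2, h.1.2⟩, fun h => ⟨⟨LieSubalgebra.mem_top x, h.2⟩, h.1⟩⟩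
  have hCs : centralizerIn ⊤ (lieNilradical 𝔤).toLieSubalgebra ⊓ 𝔰 =
      centralizerIn 𝔰 (lieNilradical 𝔤).toLieSubalgebra := by
    ext x
    exact ⟨fun h => ⟨h.2, h.1.2⟩, fun h => ⟨⟨LieSubalgebra.mem_top x, h.2⟩, h.1⟩⟩
  have hn : ∀ 𝔱 : LieSubalgebra ℝ 𝔤, IsLeviSubalgebra 𝔱 →
      centralizerIn 𝔱 (lieNilradical 𝔤).toLieSubalgebra = P.toLieSubalgebra := by
    intro 𝔱 h𝔱
    ext x
    refine ⟨fun h => ?_, fun h => ⟨(hP 𝔱 h𝔱).1 x h, mem_nilradicalCentralizer.mp (hPC h)⟩⟩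
    have := (hP 𝔱 h𝔱).2 x (mem_nilradicalCentralizer.mpr h.2)
    rwa [h𝔱.proj_of_mem h.1] at this
  have hr : ∀ 𝔱 : LieSubalgebra ℝ 𝔤, IsLeviSubalgebra 𝔱 →
      centralizerIn 𝔱 (radical ℝ 𝔤).toLieSubalgebra = P.toLieSubalgebra := by
    intro 𝔱 h𝔱
    refine le_antisymm ?_ fun x h => ⟨(hP 𝔱 h𝔱).1 x h, hPr x h⟩
    rw [← hn 𝔱 h𝔱]
    exact fun x h => ⟨h.1, fun y hy => h.2 y (lieNilradical_le_radical hy)⟩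
  have hz := centralizerIn_radical_lieNilradical (L := 𝔤)
  have hsup : P.toLieSubalgebra.toSubmodule ⊔ (centerOfIdeal (lieNilradical 𝔤)).toSubmodule =
      (centralizerIn ⊤ (lieNilradical 𝔤).toLieSubalgebra).toSubmodule := by
    rw [← hz, ← hCr, hC]
    refine le_antisymm (sup_le hPC inf_le_left) fun x hx => ?_
    -- Split `x` into its projection, in `P`, and the remainder, in `C ∩ r`.
    have hx' := (hP 𝔰 h𝔰).2 x hx
    rw [← add_sub_cancel (h𝔰.proj x : 𝔤) x]
    exact Submodule.add_mem_sup hx' ⟨sub_mem hx (hPC hx'), h𝔰.sub_proj_mem x⟩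
  have hdisj : Disjoint P.toLieSubalgebra.toSubmodule
      (centerOfIdeal (lieNilradical 𝔤)).toSubmodule := by
    rw [← hz, Submodule.disjoint_def]
    exact fun x hx hx' => h𝔰.eq_zero hx'.1 ((hP 𝔰 h𝔰).1 x hx)
  have hcomm : ∀ x ∈ P, ∀ y ∈ centerOfIdeal (lieNilradical 𝔤), ⁅x, y⁆ = 0 := by
    rw [← hz]
    exact fun x hx y hy => hPr x hx y hy.1
  have hzideal : IsIdeal (centerOfIdeal (lieNilradical 𝔤)) := by
    rw [← hz, ← hCr, hC]
    exact fun x y hy => ⟨lie_mem_right ℝ 𝔤 _ _ _ hy.1, lie_mem_right ℝ 𝔤 _ _ _ hy.2⟩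
  have hzabel : IsLieAbelian (centerOfIdeal (lieNilradical 𝔤)) := by
    refine ⟨fun x y => Subtype.ext ?_⟩
    obtain ⟨x, hx⟩ := x
    obtain ⟨y, ⟨y, -, rfl⟩⟩ := y
    rw [← hz] at hx
    exact hx.2 y y.2
  have := h𝔰.isSemisimple
  have hparts : IsCompl
      (sSup {I : LieIdeal ℝ 𝔰 | IsSimple ℝ I ∧ IsCompactType I})
      (sSup {I : LieIdeal ℝ 𝔰 | IsSimple ℝ I ∧ ¬ IsCompactType I}) :=
    IsSemisimple.isCompl_sSup_isSimple fun I => IsCompactType I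
  have hPmap : P.toLieSubalgebra = (P.comap 𝔰.incl).toLieSubalgebra.map 𝔰.incl := by
    ext x
    exact ⟨fun h => ⟨⟨x, (hP 𝔰 h𝔰).1 x h⟩, h, rfl⟩, fun ⟨y, hy, h⟩ => h ▸ hy⟩
  have hpartr : ∀ I : LieIdeal ℝ 𝔰, ∀ x ∈ P.comap 𝔰.incl ⊓ I, ∀ a ∈ radical ℝ 𝔤,
      ⁅(x : 𝔤), a⁆ = 0 := fun I x hx => hPr x hx.1
  have hpartP : ∀ I : LieIdeal ℝ 𝔰, (P.comap 𝔰.incl ⊓ I).toLieSubalgebra.map 𝔰.incl ≤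
      P.toLieSubalgebra := by
    rintro I _ ⟨y, hy, rfl⟩
    exact hy.1
  have hpdisj := disjoint_map_incl (hparts.disjoint.mono
    (inf_le_right (a := P.comap 𝔰.incl)) (inf_le_right (a := P.comap 𝔰.incl)))
  have hpsup := map_incl_sup (P.comap 𝔰.incl ⊓ _) (P.comap 𝔰.incl ⊓ _) |>.trans
    (congrArg (fun I : LieIdeal ℝ 𝔰 => (I.toLieSubalgebra.map 𝔰.incl).toSubmodule)
      (IsSemisimple.inf_sup_inf_of_isCompl (P.comap 𝔰.incl) hparts))
  rw [← hPmap] at hpsup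
  have hpcomm : ∀ x ∈ (P.comap 𝔰.incl ⊓ sSup {I : LieIdeal ℝ 𝔰 | IsSimple ℝ I ∧
        IsCompactType I}).toLieSubalgebra.map 𝔰.incl,
      ∀ y ∈ (P.comap 𝔰.incl ⊓ sSup {I : LieIdeal ℝ 𝔰 | IsSimple ℝ I ∧
        ¬ IsCompactType I}).toLieSubalgebra.map 𝔰.incl, ⁅x, y⁆ = 0 := by
    rintro _ ⟨x, hx, rfl⟩ _ ⟨y, hy, rfl⟩
    exact congrArg Subtype.val (lie_eq_zero_of_disjoint hparts.disjoint hx.2 hy.2)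
  rw [hCr, hCs, hz, hn 𝔰 h𝔰, hr 𝔰 h𝔰, compactPart, noncompactPart,
    centralizerIn_radical_eq_map (hr 𝔰 h𝔰), centralizerIn_radical_eq_map (hr 𝔰 h𝔰)]
  refine ⟨⟨isLieDirectSum_pair (sup_comm _ _ |>.trans hsup) hdisj.symm fun x hx y hy => ?_,
      rfl, rfl⟩, ⟨rfl, hzideal, hzabel⟩, ⟨rfl, fun x y hy => lie_mem_right ℝ 𝔤 P x y hy, ?_⟩,
    fun 𝔱 h𝔱 => ⟨(hP 𝔱 h𝔱).1, hr 𝔱 h𝔱⟩, isLieDirectSum_pair hpsup hpdisj hpcomm,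
    isLieDirectSum_triple (hpsup ▸ hsup) hpdisj (hpsup ▸ hdisj) hpcomm
      (fun x hx => hcomm x (hpartP _ hx)) (fun x hx => hcomm x (hpartP _ hx)),
    ⟨h𝔰.isIdeal_map_incl (hpartr _), IsSemisimple.map_incl 𝔰 _⟩,
    ⟨h𝔰.isIdeal_map_incl (hpartr _), IsSemisimple.map_incl 𝔰 _⟩⟩
  · rw [← lie_skew, hcomm y hy x hx, neg_zero]
  · rw [hPmap]
    exact IsSemisimple.map_incl 𝔰 _
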